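/- A Berge cycle of length $k\ge 2$ in a hypergraph consists of $k$ distinct vertices $v_1,\dots,v_k$ and $k$ distinct edges $E_1,\dots,E_k$ with $\{v_i,v_{i+1}\}\subseteq E_i$ for all $i$, indices being read modulo $k$. For $g\ge 3$ let $\mathrm{ex}_r(N,\mathcal{C}_{<g})$ denote the maximum number of edges of an $r$-uniform hypergraph on $N$ vertices that contains no Berge cycle of length $k$ for any $2\le k\le g-1$. Theorem. For every integer $r\ge 2$ there are constants $c_r>0$ and $c_r'>0$, depending only on $r$, such that for all integers $N\ge r$: (a) $\mathrm{ex}_r(N,\mathcal{C}_{<5})\ge c_r\,N^{10/7}$, and (b) $\mathrm{ex}_r(N,\mathcal{C}_{<6})\ge c_r'\,N^{4/3}$. -/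

import Mathlib

namespace BergeTuran

/-- A hypergraph with vertex set `V` is given by its set `H` of edges; it is `r`-uniform if
`H ⊆ (V choose r)`, i.e. if every edge has exactly `r` elements. -/
def IsUniform {V : Type*} (r : ℕ) (H : Finset (Finset V)) : Prop :=
  ∀ e ∈ H, e.card = r

/-- `H` contains a Berge cycle of length `k`: `k` distinct vertices `v i` and `k` distinct edges
`E i` of `H` with `{v i, v (i + 1)} ⊆ E i`, the indices being read modulo `k`.
Only used for `2 ≤ k`. -/
def HasBergeCycle {V : Type*} (H : Finset (Finset V)) (k : ℕ) : Prop :=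
  ∃ (v : ZMod k → V) (E : ZMod k → Finset V),
    Function.Injective v ∧ Function.Injective E ∧
      ∀ i : ZMod k, E i ∈ H ∧ v i ∈ E i ∧ v (i + 1) ∈ E i

/-- `H` is `𝒞_{<g}`-free (has girth at least `g`): it contains no Berge cycle of any
length `k` with `2 ≤ k ≤ g - 1`. -/
def IsBergeCycleFree {V : Type*} (g : ℕ) (H : Finset (Finset V)) : Prop :=
  ∀ k : ℕ, 2 ≤ k → k < g → ¬ HasBergeCycle H k

open scoped Classical in
/-- The Turán number `ex_r(N, 𝒞_{<g})`: the maximum number of edges of a `𝒞_{<g}`-free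
`r`-uniform hypergraph on `N` vertices. -/
noncomputable def exBerge (r N g : ℕ) : ℕ :=
  (Finset.univ.filter fun H : Finset (Finset (Fin N)) =>
    IsUniform r H ∧ IsBergeCycleFree g H).sup Finset.card

end BergeTuran

/-! ### Transport to `Fin N` and the trivial bound -/

namespace BergeTuran

/-! Take a finite `K`-vector space `G`, points `f h` in `G` and scalars `a i`, and let the edges be
the sets `{(i, x + a i • f h)}`: there are `r * |G|` vertices and `|G| * |ι|` edges. Going around a
Berge cycle, the steps `d j`, differences of consecutive `a i`, are nonzero and sum to zero, also
when weighted by the points `f h`. If any fewer than `g` points are affinely independent, the steps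
with a common label `h` cancel, so every label repeats. Neighbouring labels differ, so for `k < 6`
only the pattern `h, h', h, h'` survives, and it is excluded by taking the `a i` to be a Sidon set
(`isBergeCycleFree_translateEdge`).

It remains to find many independent points over `ZMod p`. For (a), the `p ^ 3` points `(t, t², N t)`
with `t` in the cubic extension lie in a space of size `p ^ 7`, and any four are independent
(`cubic_affine_independent`). For (b), the subgroup of order `p² - p + 1` in the units of the field
of size `p ^ 6` has any five elements independent (`IsTorusPoint.affine_independent`). Bertrand's
postulate passes from primes to all `N`. -/

theorem HasBergeCycle.of_map {V W : Type*} (φ : V ↪ W) {H : Finset (Finset V)} {k : ℕ}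
    (h : HasBergeCycle (H.map (Finset.mapEmbedding φ).toEmbedding) k) : HasBergeCycle H k := by
  obtain ⟨v, E, hv, hE, hvE⟩ := h
  have h1 : ∀ i, ∃ e ∈ H, e.map φ = E i := fun i => by simpa using (hvE i).1
  choose e heH he using h1
  have h2 : ∀ i, ∃ x ∈ e i, φ x = v i := fun i => by
    have := (hvE i).2.1
    rw [← he i] at this
    simpa using this
  choose x hxe hx using h2
  refine ⟨x, e, fun i j hij => hv ?_, fun i j hij => hE ?_, fun i => ⟨heH i, hxe i, ?_⟩⟩
  · rw [← hx, ← hx, hij]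
  · rw [← he, ← he, hij]
  · have := (hvE i).2.2
    rw [← he i, ← hx (i + 1)] at this
    simpa using this

/-- Every `r`-uniform hypergraph of girth at least `g` on at most `N` vertices bounds the Turán number
from below. -/
theorem card_le_exBerge {V : Type*} [Fintype V] {r N g : ℕ} (hV : Fintype.card V ≤ N)
    {H : Finset (Finset V)} (hu : IsUniform r H) (hf : IsBergeCycleFree g H) :
    H.card ≤ exBerge r N g := by
  classical
  obtain ⟨φ⟩ : Nonempty (V ↪ Fin N) := Function.Embedding.nonempty_of_card_le (by simpa using hV)
  rw [← Finset.card_map (Finset.mapEmbedding φ).toEmbedding]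
  unfold exBerge
  refine Finset.le_sup (f := Finset.card) ?_
  simp only [Finset.mem_filter, Finset.mem_univ, true_and]
  refine ⟨?_, fun k hk hkg hc => hf k hk hkg (hc.of_map φ)⟩
  intro e he
  obtain ⟨e', he', rfl⟩ := Finset.mem_map.1 he
  simpa using hu e' he'

/-- A single edge carries no Berge cycle, which needs two distinct edges. This covers the `N` too
small for a suitable prime. -/
theorem one_le_exBerge {r N : ℕ} (hN : r ≤ N) (g : ℕ) : 1 ≤ exBerge r N g := by
  have := card_le_exBerge (V := Fin N) (r := r) (N := N) (g := g) (by simp)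
    (H := {Finset.univ.map (Fin.castLEEmb hN)}) (by intro e he; simp_all) (by
      rintro k hk - ⟨v, E, -, hE, h⟩
      have : Fact (1 < k) := ⟨hk⟩
      refine zero_ne_one (α := ZMod k) (hE ?_)
      rw [Finset.mem_singleton.1 (h 0).1, Finset.mem_singleton.1 (h 1).1])
  simpa using this

/-! ### Hypergraphs from affinely independent points -/

section Construction

variable {ι K G : Type*} {r : ℕ}

/-- The edge `{(i, x + a i • f h) : i}` of the hypergraph of a labelled point set `f`. -/
def translateEdge [Field K] [AddCommGroup G] [Module K G] [DecidableEq G] (a : Fin r → K)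
    (f : ι → G) (q : G × ι) : Finset (Fin r × G) :=
  Finset.univ.image fun i => (i, q.1 + a i • f q.2)

theorem mem_translateEdge [Field K] [AddCommGroup G] [Module K G] [DecidableEq G] {a : Fin r → K}
    {f : ι → G} {q : G × ι} {v : Fin r × G} :
    v ∈ translateEdge a f q ↔ v.2 = q.1 + a v.1 • f q.2 := by
  obtain ⟨i, y⟩ := v
  simp [translateEdge, eq_comm]

theorem card_translateEdge [Field K] [AddCommGroup G] [Module K G] [DecidableEq G] (a : Fin r → K)
    (f : ι → G) (q : G × ι) : (translateEdge a f q).card = r := by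
  rw [translateEdge, Finset.card_image_of_injective _ fun i j h => (Prod.ext_iff.1 h).1]
  simp

theorem translateEdge_injective [Field K] [AddCommGroup G] [Module K G] [DecidableEq G]
    (hr : 2 ≤ r) {a : Fin r → K} (ha : Function.Injective a) {f : ι → G}
    (hf : Function.Injective f) : Function.Injective (translateEdge a f) := by
  intro q q' h
  have h1 : ∀ i, q.1 + a i • f q.2 = q'.1 + a i • f q'.2 := fun i => by
    have : (i, q.1 + a i • f q.2) ∈ translateEdge a f q := mem_translateEdge.2 rfl
    rw [h] at this
    exact mem_translateEdge.1 this
  have h01 : a ⟨0, by omega⟩ - a ⟨1, by omega⟩ ≠ 0 := sub_ne_zero.2 fun h => by simpa using ha h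
  have h2 : (a ⟨0, by omega⟩ - a ⟨1, by omega⟩) • (f q.2 - f q'.2) = 0 := by
    have : (a ⟨0, by omega⟩ - a ⟨1, by omega⟩) • (f q.2 - f q'.2) =
        (q.1 + a ⟨0, by omega⟩ • f q.2) - (q.1 + a ⟨1, by omega⟩ • f q.2) -
        ((q'.1 + a ⟨0, by omega⟩ • f q'.2) - (q'.1 + a ⟨1, by omega⟩ • f q'.2)) := by module
    rw [this, h1, h1, sub_self]
  have h3 : f q.2 = f q'.2 := sub_eq_zero.1 ((smul_eq_zero.1 h2).resolve_left h01)
  have h4 := h1 ⟨0, by omega⟩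
  rw [h3] at h4
  exact Prod.ext (add_right_cancel h4) (hf h3)

/-- No function on a cycle of length `2`, `3` or `5` with distinct values at neighbours attains
each value at least twice, and on a cycle of length `4` such a function has period `2`. -/
theorem cycle_repetition {k : ℕ} (hk : 2 ≤ k) (hk' : k < 6) (h : ZMod k → ι)
    (hadj : ∀ j, h j ≠ h (j + 1)) (hrep : ∀ j, ∃ j', j' ≠ j ∧ h j' = h j) : k = 4 := by
  interval_cases k
  · obtain ⟨j, hj, hj'⟩ := hrep 0
    have h0 := hadj 0
    fin_cases j
    · exact absurd rfl hj
    · exact absurd hj'.symm h0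
  · obtain ⟨j, hj, hj'⟩ := hrep 0
    fin_cases j
    · exact absurd rfl hj
    · exact absurd hj'.symm (hadj 0)
    · exact absurd hj' (hadj 2)
  · rfl
  -- Positions with equal values are pairwise non-adjacent, so at most two; the classes would all be
  -- pairs, but 5 is odd.
  · have e : ∀ j : Fin 5, ∃ j' : Fin 5, j' ≠ j ∧ h j' = h j := hrep
    have a0 : h (0 : Fin 5) ≠ h (1 : Fin 5) := hadj 0
    have a1 : h (1 : Fin 5) ≠ h (2 : Fin 5) := hadj 1
    have a2 : h (2 : Fin 5) ≠ h (3 : Fin 5) := hadj 2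
    have a3 : h (3 : Fin 5) ≠ h (4 : Fin 5) := hadj 3
    have a4 : h (4 : Fin 5) ≠ h (0 : Fin 5) := hadj 4
    simp only [Fin.exists_fin_succ, Fin.forall_fin_succ] at e
    simp at e
    grind

theorem sum_cycle_sub {A : Type*} [AddCommGroup A] {k : ℕ} [NeZero k] (s : ZMod k → A) :
    ∑ j, (s (j + 1) - s j) = 0 := by
  rw [Finset.sum_sub_distrib, sub_eq_zero]
  exact Equiv.sum_comp (Equiv.addRight (1 : ZMod k)) s

theorem isBergeCycleFree_translateEdge [Field K] [AddCommGroup G] [Module K G] [Fintype G]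
    [Fintype ι] [DecidableEq G] {g : ℕ} (hg : g ≤ 6) {a : Fin r → K} (ha : Function.Injective a)
    (hS : ∀ i j k l, a i + a k = a j + a l → i = j ∨ i = l) {f : ι → G}
    (hf : ∀ T : Finset ι, T.card < g → ∀ c : ι → K, ∑ i ∈ T, c i = 0 →
      ∑ i ∈ T, c i • f i = 0 → ∀ i ∈ T, c i = 0) :
    IsBergeCycleFree g (Finset.univ.image (translateEdge a f)) := by
  have := Classical.decEq ι
  rintro k hk hkg ⟨v, E, hv, hE, hvE⟩
  have : Fact (1 < k) := ⟨hk⟩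
  have : NeZero k := ⟨by omega⟩
  have h1 : ∀ j, ∃ q, translateEdge a f q = E j := fun j => by simpa using (hvE j).1
  choose q hq using h1
  have m1 : ∀ j, (v j).2 = (q j).1 + a (v j).1 • f (q j).2 := fun j =>
    mem_translateEdge.1 (by rw [hq]; exact (hvE j).2.1)
  have m2 : ∀ j, (v (j + 1)).2 = (q j).1 + a (v (j + 1)).1 • f (q j).2 := fun j =>
    mem_translateEdge.1 (by rw [hq]; exact (hvE j).2.2)
  have hp : ∀ j, (v j).1 ≠ (v (j + 1)).1 := fun j hj => by
    have : v j = v (j + 1) := Prod.ext hj (by rw [m1, m2, hj])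
    simpa using hv this
  have hadj : ∀ j, (q j).2 ≠ (q (j + 1)).2 := fun j hj => by
    have h2 : (q j).1 = (q (j + 1)).1 := by
      have := (m2 j).symm.trans (m1 (j + 1))
      rw [hj] at this
      exact add_right_cancel this
    have h3 : E j = E (j + 1) := by rw [← hq, ← hq, Prod.ext h2 hj]
    simpa using hE h3
  set d : ZMod k → K := fun j => a (v (j + 1)).1 - a (v j).1 with hd
  have hd0 : ∀ j, d j ≠ 0 := fun j h => hp j (ha (sub_eq_zero.1 h)).symm
  -- Collecting the steps by label turns the two closing-up identities into an affine relation among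
  -- fewer than `g` distinct points.
  set c : ι → K := fun h => ∑ j with (q j).2 = h, d j with hc
  have hmem : ∀ j ∈ Finset.univ, (fun j => (q j).2) j ∈ Finset.univ.image fun j => (q j).2 :=
    fun j hj => Finset.mem_image_of_mem _ hj
  have hc0 : ∀ h ∈ Finset.univ.image fun j => (q j).2, c h = 0 := by
    refine hf _ (lt_of_le_of_lt Finset.card_image_le (by simpa using hkg)) c ?_ ?_
    · simp only [hc]
      rw [Finset.sum_fiberwise_of_maps_to hmem]
      exact sum_cycle_sub fun j => a (v j).1
    · have : ∀ h ∈ Finset.univ.image fun j => (q j).2,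
          c h • f h = ∑ j with (q j).2 = h, d j • f (q j).2 := by
        intro h _
        rw [hc, Finset.sum_smul]
        refine Finset.sum_congr rfl fun j hj => ?_
        rw [(Finset.mem_filter.1 hj).2]
      rw [Finset.sum_congr rfl this,
        Finset.sum_fiberwise_of_maps_to hmem,
        ← sum_cycle_sub fun j => (v j).2]
      refine Finset.sum_congr rfl fun j _ => ?_
      rw [m1 j, m2 j, hd, sub_smul]
      abel
  have hc0' : ∀ j, ∑ j' with (q j').2 = (q j).2, d j' = 0 := fun j =>
    hc0 _ (Finset.mem_image_of_mem _ (Finset.mem_univ j))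
  have hrep : ∀ j, ∃ j', j' ≠ j ∧ (q j').2 = (q j).2 := by
    intro j
    by_contra! hj
    have : (Finset.univ.filter fun j' => (q j').2 = (q j).2) = {j} := by
      ext j'
      simp only [Finset.mem_filter, Finset.mem_univ, true_and, Finset.mem_singleton]
      exact ⟨fun h => by_contra fun h' => hj j' h' h, fun h => h ▸ rfl⟩
    have h0 := hc0' j
    rw [this, Finset.sum_singleton] at h0
    exact hd0 j h0
  obtain rfl := cycle_repetition hk (by omega) (fun j => (q j).2) hadj hrep
  have hfil : (Finset.univ.filter fun j' : ZMod 4 => (q j').2 = (q 0).2) = {0, 2} := by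
    have h0 := hadj 0
    have h3 := hadj 3
    have h2 : (q 2).2 = (q 0).2 := by
      obtain ⟨j, hj, hj'⟩ := hrep 0
      fin_cases j
      · exact absurd rfl hj
      · exact absurd hj'.symm h0
      · exact hj'
      · exact absurd hj' h3
    ext j
    simp only [Finset.mem_filter, Finset.mem_univ, true_and, Finset.mem_insert,
      Finset.mem_singleton]
    fin_cases j
    · exact ⟨fun _ => Or.inl rfl, fun _ => rfl⟩
    · exact ⟨fun h => absurd h.symm h0,
        fun h => absurd h (show ¬((1 : ZMod 4) = 0 ∨ (1 : ZMod 4) = 2) by decide)⟩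
    · exact ⟨fun _ => Or.inr rfl, fun _ => h2⟩
    · exact ⟨fun h => absurd h h3,
        fun h => absurd h (show ¬((3 : ZMod 4) = 0 ∨ (3 : ZMod 4) = 2) by decide)⟩
  have h0 := hc0' 0
  rw [hfil, Finset.sum_pair (by decide)] at h0
  -- Labels alternate, so `d 0 + d 2 = 0` is a Sidon equation; either solution makes two consecutive
  -- vertices share a layer.
  have h5 : a (v 1).1 + a (v 3).1 = a (v 0).1 + a (v 2).1 := by
    have e1 : d 0 = a (v 1).1 - a (v 0).1 := rfl
    have e2 : d 2 = a (v 3).1 - a (v 2).1 := rfl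
    rw [e1, e2] at h0
    linear_combination h0
  rcases hS _ _ _ _ h5 with h | h
  · exact hp 0 h.symm
  · exact hp 1 h

end Construction

end BergeTuran

namespace BergeTuran

/-! ### Five independent points on a torus -/

section Torus

variable {F : Type*} [Field F]

/-- The points of the torus on which the endomorphism `φ` satisfies `φ² - φ + 1 = 0`. -/
def IsTorusPoint (φ : F →+* F) (x : F) : Prop :=
  x ≠ 0 ∧ φ (φ x) = φ x / x

variable {φ : F →+* F}

theorem IsTorusPoint.inv {x : F} (hx : IsTorusPoint φ x) : IsTorusPoint φ x⁻¹ :=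
  ⟨inv_ne_zero hx.1, by rw [map_inv₀, map_inv₀, hx.2, inv_div_inv, inv_div]⟩

theorem IsTorusPoint.div {x y : F} (hx : IsTorusPoint φ x) (hy : IsTorusPoint φ y) :
    IsTorusPoint φ (x / y) :=
  ⟨div_ne_zero hx.1 hy.1, by
    rw [map_div₀, map_div₀, hx.2, hy.2, div_div_div_comm]⟩

/-- Applying `φ` to a collinearity relation gives a second equation in `φ y, φ z`; eliminating `φ z`
leaves a product of nonzero factors. -/
theorem IsTorusPoint.not_collinear_one {y z : F} (hy : IsTorusPoint φ y) (hz : IsTorusPoint φ z)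
    (hy1 : y ≠ 1) (hz1 : z ≠ 1) (hyz : y ≠ z) : (φ z - 1) * (y - 1) ≠ (φ y - 1) * (z - 1) := by
  intro h
  have h' := congrArg φ h
  simp only [map_mul, map_sub, map_one, hy.2, hz.2] at h'
  have hy' : φ y - 1 ≠ 0 := sub_ne_zero.2 ((map_ne_one_iff φ φ.injective).2 hy1)
  have hyy : φ y ≠ y := fun e => hy1 (by
    have := hy.2
    rw [e, e, div_self hy.1] at this
    exact this)
  have hy0 := hy.1
  have hz0 := hz.1
  field_simp at h'
  generalize φ y = b at *
  generalize φ z = d at *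
  have e1 : d - 1 = (b - 1) / (y - 1) * (z - 1) := by
    field_simp [sub_ne_zero.2 hy1]
    linear_combination h
  have key : (z - 1) * (b - 1) * (b - y) * (y - z) = 0 := by
    have := sub_ne_zero.2 hy1
    have e2 : d = 1 + (b - 1) / (y - 1) * (z - 1) := by linear_combination e1
    rw [e2] at h'
    field_simp at h'
    linear_combination h'
  have := sub_ne_zero.2 hz1
  have := sub_ne_zero.2 hyy
  have := sub_ne_zero.2 hyz
  simp_all

/-- Three points `(x, φ x)` of the torus are never collinear. -/
theorem IsTorusPoint.not_collinear {x y z : F} (hx : IsTorusPoint φ x) (hy : IsTorusPoint φ y)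
    (hz : IsTorusPoint φ z) (hxy : x ≠ y) (hxz : x ≠ z) (hyz : y ≠ z) :
    (φ z - φ x) * (y - x) - (φ y - φ x) * (z - x) ≠ 0 := by
  have hx0 := hx.1
  have hx0' : φ x ≠ 0 := by simpa using hx0
  intro h
  refine (hy.div hx).not_collinear_one (hz.div hx) (fun e => hxy ?_) (fun e => hxz ?_)
    (fun e => hyz ?_) ?_
  · exact ((div_eq_one_iff_eq hx0).1 e).symm
  · exact ((div_eq_one_iff_eq hx0).1 e).symm
  · exact (div_left_inj' hx0).1 e
  · rw [map_div₀, map_div₀]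
    field_simp
    linear_combination h

/-- Any five points of the torus are affinely independent over the fixed field of `φ`. -/
theorem IsTorusPoint.affine_independent {X T : Finset F} (hX : ∀ x ∈ X, IsTorusPoint φ x)
    (hX5 : 5 ≤ X.card) (hTX : T ⊆ X) (hT : T.card ≤ 5) {c : F → F} (hc : ∀ x, φ (c x) = c x)
    (h0 : ∑ x ∈ T, c x = 0) (h1 : ∑ x ∈ T, c x * x = 0) : ∀ x ∈ T, c x = 0 := by
  classical
  have frob : ∀ f : F → F, ∑ x ∈ T, c x * f x = 0 → ∑ x ∈ T, c x * φ (f x) = 0 := fun f hf => by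
    have := congrArg φ hf
    simpa [map_sum, map_mul, hc] using this
  have h2 := frob _ h1
  have h3 := frob _ h2
  have h4 := frob _ h3
  have h5 := frob _ h4
  have h6 := frob _ h5
  -- The iterates of `φ` at `x` are `x`, `φ x`, `φ x / x` and their inverses. Together with `1`
  -- these are all the monomials of a linear form in `(1, x, φ x)` times one in `(1, x⁻¹, (φ x)⁻¹)`.
  have key : ∀ A B C A' B' C' : F,
      ∑ x ∈ T, c x * ((A + B * x + C * φ x) * (A' + B' * x⁻¹ + C' * (φ x)⁻¹)) = 0 := by
    intro A B C A' B' C'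
    have : ∀ x ∈ T, c x * ((A + B * x + C * φ x) * (A' + B' * x⁻¹ + C' * (φ x)⁻¹)) =
        (A * A' + B * B' + C * C') * c x + B * A' * (c x * x) + C * A' * (c x * φ x) +
        C * B' * (c x * φ (φ x)) + A * B' * (c x * φ (φ (φ x))) +
        A * C' * (c x * φ (φ (φ (φ x)))) + B * C' * (c x * φ (φ (φ (φ (φ x))))) := by
      intro x hx
      have hx0 := (hX x (hTX hx)).1
      have hx2 := (hX x (hTX hx)).2
      have hx0' : φ x ≠ 0 := by simpa using hx0
      simp only [hx2, map_div₀]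
      field_simp
      ring
    rw [Finset.sum_congr rfl this]
    simp only [Finset.sum_add_distrib, ← Finset.mul_sum, h0, h1, h2, h3, h4, h5, h6]
    ring
  intro m hm
  -- Pad with points of `X` so that exactly four points other than `m` have to be killed.
  obtain ⟨R, hR1, hR2, hR⟩ := Finset.exists_subsuperset_card_eq (s := T.erase m) (t := X.erase m)
    (n := 4) (Finset.erase_subset_erase m hTX) (by rw [Finset.card_erase_of_mem hm]; omega)
    (by rw [Finset.card_erase_of_mem (hTX hm)]; omega)
  obtain ⟨p, q, r, s, hpq, hpr, hps, hqr, hqs, hrs, rfl⟩ := Finset.card_eq_four.1 hR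
  have mem : ∀ x ∈ ({p, q, r, s} : Finset F), IsTorusPoint φ x ∧ x ≠ m := fun x hx =>
    ⟨hX x (Finset.mem_of_mem_erase (hR2 hx)), Finset.ne_of_mem_erase (hR2 hx)⟩
  obtain ⟨hp, hpm⟩ := mem p (by simp)
  obtain ⟨hq, hqm⟩ := mem q (by simp)
  obtain ⟨hr, hrm⟩ := mem r (by simp)
  obtain ⟨hs, hsm⟩ := mem s (by simp)
  have hmX := hX m (hTX hm)
  -- The first form is the line through `p, q`, the second the line through `r⁻¹, s⁻¹`. Only the
  -- term of `m` survives, and it is nonzero by non-collinearity.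
  have k := key ((φ q - φ p) * p - φ p * (q - p)) (-(φ q - φ p)) (q - p)
    ((φ s⁻¹ - φ r⁻¹) * r⁻¹ - φ r⁻¹ * (s⁻¹ - r⁻¹)) (-(φ s⁻¹ - φ r⁻¹)) (s⁻¹ - r⁻¹)
  rw [Finset.sum_eq_single_of_mem m hm] at k
  · refine (mul_eq_zero.1 k).resolve_right (mul_ne_zero ?_ ?_)
    · convert hp.not_collinear hq hmX hpq hpm hqm using 1
      ring
    · convert hr.inv.not_collinear hs.inv hmX.inv (inv_injective.ne hrs) (inv_injective.ne hrm)
        (inv_injective.ne hsm) using 1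
      rw [map_inv₀ φ m]
      ring
  · intro x hx hxm
    have hx' := hR1 (Finset.mem_erase.2 ⟨hxm, hx⟩)
    simp only [Finset.mem_insert, Finset.mem_singleton] at hx'
    rcases hx' with rfl | rfl | rfl | rfl
    · ring
    · ring
    · rw [map_inv₀ φ x]
      ring
    · rw [map_inv₀ φ x]
      ring

end Torus

/-! ### Four independent points from a cubic norm -/

section Cubic

variable {K L : Type*} [Field K] [Field L] [Algebra K L]

theorem sum_mul_eval_eq_zero {n : ℕ} {T : Finset L} {c : L → L}
    (h : ∀ j < n, ∑ x ∈ T, c x * x ^ j = 0) {p : Polynomial L} (hp : p.natDegree < n) :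
    ∑ x ∈ T, c x * p.eval x = 0 := by
  simp only [Polynomial.eval_eq_sum_range' hp, Finset.mul_sum]
  rw [Finset.sum_comm]
  refine Finset.sum_eq_zero fun j hj => ?_
  have := congrArg (p.coeff j * ·) (h j (Finset.mem_range.1 hj))
  simp only [Finset.mul_sum, mul_zero] at this
  rw [← this]
  exact Finset.sum_congr rfl fun x _ => by ring

/-- Testing against the polynomial that vanishes on `T` except at `m` isolates `c m`. -/
theorem eq_zero_of_sum_mul_pow {n : ℕ} {T : Finset L} (hT : T.card ≤ n) {c : L → L}
    (h : ∀ j < n, ∑ x ∈ T, c x * x ^ j = 0) : ∀ x ∈ T, c x = 0 := by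
  classical
  intro m hm
  have hd : (∏ y ∈ T.erase m, (Polynomial.X - Polynomial.C y)).natDegree < n := by
    rw [Polynomial.natDegree_prod_of_monic _ _ fun y _ => Polynomial.monic_X_sub_C y]
    simp only [Polynomial.natDegree_X_sub_C, Finset.sum_const, smul_eq_mul, mul_one]
    exact lt_of_lt_of_le (Finset.card_erase_lt_of_mem hm) hT
  have k := sum_mul_eval_eq_zero h hd
  simp only [Polynomial.eval_prod, Polynomial.eval_sub, Polynomial.eval_X, Polynomial.eval_C] at k
  rw [Finset.sum_eq_single_of_mem m hm] at k
  · refine (mul_eq_zero.1 k).resolve_right (Finset.prod_ne_zero_iff.2 fun y hy => ?_)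
    exact sub_ne_zero.2 (Finset.ne_of_mem_erase hy).symm
  · intro x hx hxm
    rw [Finset.prod_eq_zero (Finset.mem_erase.2 ⟨hxm, hx⟩) (sub_self x), mul_zero]

/-- A cubic extension contains no roots of quadratic polynomials outside the ground field. -/
theorem mem_range_of_quadratic (hL : Module.finrank K L = 3) {a b d : K} (hb : b ≠ 0) {x : L}
    (h : algebraMap K L a * x ^ 2 + algebraMap K L b * x + algebraMap K L d = 0) :
    x ∈ (algebraMap K L).range := by
  have : FiniteDimensional K L := Module.finite_of_finrank_pos (by omega)
  have hx : IsIntegral K x := Algebra.IsIntegral.isIntegral x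
  set p : Polynomial K := Polynomial.C a * Polynomial.X ^ 2 + Polynomial.C b * Polynomial.X +
    Polynomial.C d with hp
  have hp0 : p ≠ 0 := fun h0 => hb (by
    have := congrArg (Polynomial.coeff · 1) h0
    simpa [hp, Polynomial.coeff_X, Polynomial.coeff_C] using this)
  have h1 : (minpoly K x).natDegree ≤ 2 :=
    (Polynomial.natDegree_le_of_dvd (minpoly.dvd K x (by simpa [hp] using h)) hp0).trans
      Polynomial.natDegree_quadratic_le
  have h2 : (minpoly K x).natDegree ∣ 3 := hL ▸ minpoly.degree_dvd hx
  have h3 : (minpoly K x).natDegree = 1 :=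
    ((Nat.dvd_prime Nat.prime_three).1 h2).resolve_right (by omega)
  exact (minpoly.natDegree_eq_one_iff).1 h3

/-- Four points `(t, t², N t)` of the graph of the square and a cubic norm form satisfy no affine
relation over the ground field with nonzero coefficients. -/
theorem no_four_term_relation (hL : Module.finrank K L = 3) (h2 : (2 : K) ≠ 0) {φ : L →ₐ[K] L}
    {t₀ t₁ t₂ t₃ : L} {c₀ c₁ c₂ c₃ : K} (hc₁ : c₁ ≠ 0) (hc₂ : c₂ ≠ 0) (hc₃ : c₃ ≠ 0)
    (h02 : t₀ ≠ t₂) (h12 : t₁ ≠ t₂) (h23 : t₂ ≠ t₃)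
    (e0 : c₀ + c₁ + c₂ + c₃ = 0)
    (e1 : c₀ • t₀ + c₁ • t₁ + c₂ • t₂ + c₃ • t₃ = 0)
    (e2 : c₀ • t₀ ^ 2 + c₁ • t₁ ^ 2 + c₂ • t₂ ^ 2 + c₃ • t₃ ^ 2 = 0)
    (e3 : c₀ • (t₀ * φ t₀ * φ (φ t₀)) + c₁ • (t₁ * φ t₁ * φ (φ t₁)) +
      c₂ • (t₂ * φ t₂ * φ (φ t₂)) + c₃ • (t₃ * φ t₃ * φ (φ t₃)) = 0) : False := by
  simp only [Algebra.smul_def] at e1 e2 e3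
  have e0' := congrArg (algebraMap K L) e0
  simp only [map_add, map_zero] at e0'
  set u := t₂ - t₀ with hu
  have hu0 : u ≠ 0 := sub_ne_zero.2 h02.symm
  have hinj := (algebraMap K L).injective
  have hc₃' : algebraMap K L c₃ ≠ 0 := by simpa using hc₃
  have hc₂' : algebraMap K L c₂ ≠ 0 := by simpa using hc₂
  -- Eliminating `t₃` from the linear and square relations gives a quadratic for the ratio. Its
  -- leading coefficient may vanish, but `2 * c₁ * c₂` does not.
  obtain ⟨x, hx⟩ := mem_range_of_quadratic (x := (t₁ - t₀) / u) hL
    (a := c₁ * (c₃ + c₁)) (b := 2 * c₁ * c₂) (d := c₂ * (c₃ + c₂))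
    (mul_ne_zero (mul_ne_zero h2 hc₁) hc₂) (by
      have f1 : algebraMap K L c₃ * (t₃ - t₀) =
          -(algebraMap K L c₁ * (t₁ - t₀) + algebraMap K L c₂ * u) := by
        linear_combination e1 - t₀ * e0'
      have f2 : algebraMap K L c₃ * (t₃ - t₀) ^ 2 =
          -(algebraMap K L c₁ * (t₁ - t₀) ^ 2 + algebraMap K L c₂ * u ^ 2) := by
        linear_combination e2 - 2 * t₀ * e1 + t₀ ^ 2 * e0'
      simp only [map_mul, map_add, map_ofNat]
      field_simp
      linear_combination algebraMap K L c₃ * f2 -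
        (algebraMap K L c₃ * (t₃ - t₀) -
          (algebraMap K L c₁ * (t₁ - t₀) + algebraMap K L c₂ * u)) * f1)
  have ht1 : t₁ = t₀ + algebraMap K L x * u := by
    rw [hx]
    field_simp
    ring
  have ht2 : t₂ = t₀ + u := by rw [hu]; ring
  set y : K := -(c₁ * x + c₂) / c₃ with hy
  have hy' : algebraMap K L c₁ * algebraMap K L x + algebraMap K L c₂ +
      algebraMap K L c₃ * algebraMap K L y = 0 := by
    rw [← map_mul, ← map_mul, ← map_add, ← map_add, map_eq_zero_iff _ hinj, hy]
    field_simp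
    ring
  have ht3 : t₃ = t₀ + algebraMap K L y * u := by
    apply mul_left_cancel₀ hc₃'
    rw [ht1, ht2] at e1
    linear_combination e1 - t₀ * e0' - u * hy'
  clear_value y u
  subst ht1 ht2 ht3
  have s2 : algebraMap K L c₁ * algebraMap K L x ^ 2 + algebraMap K L c₂ +
      algebraMap K L c₃ * algebraMap K L y ^ 2 = 0 := by
    refine ((mul_eq_zero (a := u ^ 2)).1 ?_).resolve_left (pow_ne_zero 2 hu0)
    linear_combination e2 - t₀ ^ 2 * e0' - 2 * t₀ * u * hy'
  have hφ : φ u ≠ 0 := by simpa using hu0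
  have hφφ : φ (φ u) ≠ 0 := by simpa using hu0
  -- All four points lie on one `K`-line, where the norm is a cubic in the parameter with leading
  -- coefficient `N u ≠ 0`.
  have s3 : algebraMap K L c₁ * algebraMap K L x ^ 3 + algebraMap K L c₂ +
      algebraMap K L c₃ * algebraMap K L y ^ 3 = 0 := by
    refine ((mul_eq_zero (a := u * φ u * φ (φ u))).1 ?_).resolve_left
      (mul_ne_zero (mul_ne_zero hu0 hφ) hφφ)
    simp only [map_add, map_mul, AlgHom.commutes] at e3
    linear_combination e3 - t₀ * φ t₀ * φ (φ t₀) * e0' -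
      (u * φ t₀ * φ (φ t₀) + t₀ * φ u * φ (φ t₀) + t₀ * φ t₀ * φ (φ u)) * hy' -
      (u * φ u * φ (φ t₀) + u * φ t₀ * φ (φ u) + t₀ * φ u * φ (φ u)) * s2
  have hx1 : 1 - algebraMap K L x ≠ 0 := fun h => h12 (by linear_combination -u * h)
  have hy1 : 1 - algebraMap K L y ≠ 0 := fun h => h23 (by linear_combination u * h)
  refine mul_ne_zero (mul_ne_zero hc₂' hx1) hy1 ?_
  -- This tests the relations against `X (X - x) (X - y)`, leaving only the term at parameter 1.
  linear_combination s3 - (algebraMap K L x + algebraMap K L y) * s2 +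
    algebraMap K L x * algebraMap K L y * hy'

/-- Any four points `(t, t², N t)` are affinely independent over the ground field. -/
theorem cubic_affine_independent (hL : Module.finrank K L = 3) (h2 : (2 : K) ≠ 0) {φ : L →ₐ[K] L}
    {T : Finset L} (hT : T.card ≤ 4) {c : L → K} (h0 : ∑ t ∈ T, c t = 0)
    (h1 : ∑ t ∈ T, c t • t = 0) (hsq : ∑ t ∈ T, c t • t ^ 2 = 0)
    (h3 : ∑ t ∈ T, c t • (t * φ t * φ (φ t)) = 0) : ∀ t ∈ T, c t = 0 := by
  classical
  have hinj := (algebraMap K L).injective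
  by_contra! hne
  have red : ∀ {A : Type _} [AddCommGroup A] [Module K A] (f : L → A), ∑ t ∈ T, c t • f t = 0 →
      ∑ t ∈ T with c t ≠ 0, c t • f t = 0 := by
    intro A _ _ f hf
    rw [← hf]
    refine Finset.sum_filter_of_ne fun t _ ht hct => ht ?_
    rw [hct, zero_smul]
  have g0 : ∑ t ∈ T with c t ≠ 0, c t • (1 : L) = 0 :=
    red _ (by rw [← Finset.sum_smul, h0, zero_smul])
  have g1 := red _ h1
  have g2 := red _ hsq
  have g3 := red _ h3
  have mem : ∀ t ∈ T.filter (c · ≠ 0), c t ≠ 0 := fun t ht => (Finset.mem_filter.1 ht).2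
  have hcard : (T.filter (c · ≠ 0)).card ≤ 4 := (Finset.card_filter_le _ _).trans hT
  obtain ⟨t, ht, hct⟩ := hne
  have htm : t ∈ T.filter (c · ≠ 0) := Finset.mem_filter.2 ⟨ht, hct⟩
  generalize T.filter (c · ≠ 0) = S at *
  rcases hcard.lt_or_eq with hlt | heq
  · refine hct (hinj ?_)
    rw [map_zero]
    refine eq_zero_of_sum_mul_pow (n := 3) (T := S) (by omega)
      (c := fun t => algebraMap K L (c t)) ?_ t htm
    simp only [Algebra.smul_def, mul_one] at g0 g1 g2
    intro j hj
    interval_cases j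
    · simpa using g0
    · simpa using g1
    · exact g2
  · obtain ⟨p, q, r, s, hpq, hpr, hps, hqr, hqs, hrs, rfl⟩ := Finset.card_eq_four.1 heq
    have expand : ∀ f : L → L, ∑ t ∈ ({p, q, r, s} : Finset L), c t • f t =
        c p • f p + c q • f q + c r • f r + c s • f s := by
      intro f
      rw [Finset.sum_insert (by simp [hpq, hpr, hps]), Finset.sum_insert (by simp [hqr, hqs]),
        Finset.sum_pair hrs]
      ring
    rw [expand] at g0 g1 g2 g3
    refine no_four_term_relation hL h2 (φ := φ) (mem q (by simp)) (mem r (by simp))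
      (mem s (by simp)) hpr hqr hrs ?_ g1 g2 g3
    apply hinj
    simpa [Algebra.smul_def] using g0

end Cubic

end BergeTuran

/-! ### Choice of parameters and passage to all `N` -/

namespace BergeTuran

theorem card_mul_card_le_exBerge {ι K G : Type*} [Field K] [AddCommGroup G] [Module K G]
    [Fintype G] [Fintype ι] {r g N : ℕ} (hr : 2 ≤ r) (hg : g ≤ 6) {a : Fin r → K}
    (hS : ∀ i j k l, a i + a k = a j + a l → i = j ∨ i = l) {f : ι → G}
    (hinj : Function.Injective f)
    (hf : ∀ T : Finset ι, T.card < g → ∀ c : ι → K, ∑ i ∈ T, c i = 0 →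
      ∑ i ∈ T, c i • f i = 0 → ∀ i ∈ T, c i = 0) (hN : r * Fintype.card G ≤ N) :
    Fintype.card G * Fintype.card ι ≤ exBerge r N g := by
  classical
  have ha : Function.Injective a := fun i j h => by simpa using hS i j j j (by rw [h])
  have := card_le_exBerge (V := Fin r × G) (N := N) (by simpa using hN) (r := r)
    (H := Finset.univ.image (translateEdge a f))
    (fun e he => by
      obtain ⟨q, -, rfl⟩ := Finset.mem_image.1 he
      exact card_translateEdge a f q)
    (isBergeCycleFree_translateEdge hg ha hS hf)
  rwa [Finset.card_image_of_injective _ (translateEdge_injective hr ha hinj), Finset.card_univ,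
    Fintype.card_prod] at this

/-- Since `i + k < 2 * r`, reduction modulo `2 * r` recovers `i + k`, then `i² + k²`, which
determine the pair. -/
theorem sidon_nat {r i j k l : ℕ} (hi : i < r) (hj : j < r) (hk : k < r) (hl : l < r)
    (h : (i + 2 * r * i ^ 2) + (k + 2 * r * k ^ 2) = (j + 2 * r * j ^ 2) + (l + 2 * r * l ^ 2)) :
    i = j ∨ i = l := by
  have h1 : i + k = j + l := by
    have h' : (i + k) + 2 * r * (i ^ 2 + k ^ 2) = (j + l) + 2 * r * (j ^ 2 + l ^ 2) := by
      linarith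
    have := congrArg (· % (2 * r)) h'
    simpa [Nat.add_mul_mod_self_left, Nat.mod_eq_of_lt (show i + k < 2 * r by omega),
      Nat.mod_eq_of_lt (show j + l < 2 * r by omega)] using this
  have h2 : i ^ 2 + k ^ 2 = j ^ 2 + l ^ 2 :=
    Nat.eq_of_mul_eq_mul_left (show 0 < 2 * r by omega) (by linarith)
  zify at h1 h2 ⊢
  have hk' : (k : ℤ) = j + l - i := by linarith
  rw [hk'] at h2
  have : ((i : ℤ) - j) * (i - l) = 0 := by linarith
  rcases mul_eq_zero.1 this with h | h
  · exact Or.inl (by linarith)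
  · exact Or.inr (by linarith)

theorem exists_sidon (r p : ℕ) (hp : 2 * (r + 2 * r * r ^ 2) < p) :
    ∃ a : Fin r → ZMod p, ∀ i j k l, a i + a k = a j + a l → i = j ∨ i = l := by
  refine ⟨fun i => ((i + 2 * r * i ^ 2 : ℕ) : ZMod p), fun i j k l h => ?_⟩
  have bound : ∀ i : Fin r, (i : ℕ) + 2 * r * (i : ℕ) ^ 2 ≤ r + 2 * r * r ^ 2 := fun i => by
    gcongr <;> exact i.2.le
  have h' : (((i + 2 * r * i ^ 2) + (k + 2 * r * k ^ 2) : ℕ) : ZMod p) =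
      ((j + 2 * r * j ^ 2) + (l + 2 * r * l ^ 2) : ℕ) := by
    simpa using h
  rw [ZMod.natCast_eq_natCast_iff'] at h'
  have b1 := bound i
  have b2 := bound j
  have b3 := bound k
  have b4 := bound l
  rw [Nat.mod_eq_of_lt (by omega), Nat.mod_eq_of_lt (by omega)] at h'
  simpa [Fin.ext_iff] using sidon_nat i.2 j.2 k.2 l.2 h'

theorem pow_ten_le_exBerge {r p N : ℕ} (hr : 2 ≤ r) (hp : p.Prime)
    (hrp : 2 * (r + 2 * r * r ^ 2) < p) (hN : r * p ^ 7 ≤ N) : p ^ 10 ≤ exBerge r N 5 := by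
  have : Fact p.Prime := ⟨hp⟩
  obtain ⟨a, hS⟩ := exists_sidon r p hrp
  have : Fintype (GaloisField p 3) := Fintype.ofFinite _
  have hL : Fintype.card (GaloisField p 3) = p ^ 3 := by
    rw [← Nat.card_eq_fintype_card, GaloisField.card p 3 (by norm_num)]
  have hfr := GaloisField.finrank p (n := 3) (by norm_num)
  have h2 : (2 : ZMod p) ≠ 0 := by
    intro h
    have : ((2 : ℕ) : ZMod p) = 0 := by exact_mod_cast h
    have := Nat.le_of_dvd (by norm_num) ((ZMod.natCast_eq_zero_iff 2 p).1 this)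
    omega
  have key := card_mul_card_le_exBerge (g := 5) (N := N) hr (by norm_num) hS
    (f := fun t : GaloisField p 3 => (t, t ^ 2, Algebra.norm (ZMod p) t))
    (fun s t h => (Prod.ext_iff.1 h).1) (by
      intro T hT c h0 h1
      have hsum := Prod.ext_iff.1 h1
      have hsum' := Prod.ext_iff.1 hsum.2
      simp only [Prod.fst_sum, Prod.snd_sum, Prod.smul_fst, Prod.smul_snd, Prod.fst_zero,
        Prod.snd_zero] at hsum hsum'
      refine cubic_affine_independent hfr h2
        (φ := FiniteField.frobeniusAlgHom (ZMod p) (GaloisField p 3)) (by omega) h0 hsum.1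
        hsum'.1 ?_
      have h3 := congrArg (algebraMap (ZMod p) (GaloisField p 3)) hsum'.2
      rw [map_sum, map_zero] at h3
      rw [← h3]
      refine Finset.sum_congr rfl fun t _ => ?_
      rw [smul_eq_mul, map_mul, Algebra.smul_def, FiniteField.algebraMap_norm_eq_prod_pow, hfr]
      simp only [Finset.prod_range_succ, Finset.prod_range_zero, Nat.card_zmod,
        FiniteField.frobeniusAlgHom_apply, ZMod.card]
      ring) (by
      rw [Fintype.card_prod, Fintype.card_prod, hL, ZMod.card]
      calc _ = r * p ^ 7 := by ring
        _ ≤ N := hN)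
  rw [Fintype.card_prod, Fintype.card_prod, hL, ZMod.card] at key
  calc p ^ 10 = _ := by ring
    _ ≤ _ := key

theorem pow_eight_le_two_mul_exBerge {r p N : ℕ} (hr : 2 ≤ r) (hp : p.Prime)
    (hrp : 2 * (r + 2 * r * r ^ 2) < p) (hN : r * p ^ 6 ≤ N) : p ^ 8 ≤ 2 * exBerge r N 6 := by
  have : Fact p.Prime := ⟨hp⟩
  obtain ⟨a, hS⟩ := exists_sidon r p hrp
  have hp3 : 3 ≤ p := by omega
  -- `n = p² - p + 1` divides `p ^ 6 - 1`, and `y ^ n = 1` is the torus equation for Frobenius.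
  obtain ⟨n, hn⟩ : ∃ n, n + p = p ^ 2 + 1 := ⟨p ^ 2 + 1 - p, by
    have : p ≤ p ^ 2 := Nat.le_self_pow (by norm_num) p
    omega⟩
  have hn5 : 5 ≤ n := by nlinarith
  have hn2 : p ^ 2 ≤ 2 * n := by nlinarith
  set F := GaloisField p 6
  have : Fintype F := Fintype.ofFinite _
  have hF : Fintype.card F = p ^ 6 := by
    rw [← Nat.card_eq_fintype_card, GaloisField.card p 6 (by norm_num)]
  set X := (powMonoidHom n : Fˣ →* Fˣ).ker
  have : Fintype X := Fintype.ofFinite _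
  have hX : Fintype.card X = n := by
    rw [← Nat.card_eq_fintype_card, IsCyclic.card_powMonoidHom_ker, Nat.card_units,
      Nat.card_eq_fintype_card, hF]
    refine Nat.gcd_eq_right ?_
    zify [Nat.one_le_pow 6 p (by omega)] at hn ⊢
    have hn' : (n : ℤ) = p ^ 2 - p + 1 := by linarith
    exact ⟨((p : ℤ) ^ 3 - 1) * (p + 1), by rw [hn']; ring⟩
  set f : X → F := fun x => ((x : Fˣ) : F)
  have hf : Function.Injective f := Units.val_injective.comp Subtype.val_injective
  have key := card_mul_card_le_exBerge (g := 6) (N := N) hr (by norm_num) hS hf (by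
      intro T hT c h0 h1 i hi
      apply (algebraMap (ZMod p) F).injective
      have hmap := IsTorusPoint.affine_independent
        (φ := (FiniteField.frobeniusAlgHom (ZMod p) F : F →+* F))
        (X := Finset.univ.map ⟨f, hf⟩) (T := T.map ⟨f, hf⟩)
        (c := fun x => algebraMap (ZMod p) F (Function.extend f c 0 x))
        (by
          intro x hx
          obtain ⟨y, -, rfl⟩ := Finset.mem_map.1 hx
          refine ⟨Units.ne_zero _, ?_⟩
          have hy : f y ^ n = 1 := by
            have := congrArg Units.val (MonoidHom.mem_ker.1 y.2)
            simpa using this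
          have hy0 : f y ≠ 0 := Units.ne_zero _
          simp only [Function.Embedding.coeFn_mk, RingHom.coe_coe,
            FiniteField.frobeniusAlgHom_apply, ZMod.card]
          rw [eq_div_iff hy0, ← pow_mul, ← pow_succ, ← pow_two, ← hn, pow_add, hy, one_mul])
        (by simpa [hX] using hn5) (Finset.map_subset_map.2 (Finset.subset_univ T))
        (by rw [Finset.card_map]; omega) (fun x => (FiniteField.frobeniusAlgHom (ZMod p) F).commutes _)
        (by
          rw [Finset.sum_map]
          simp only [Function.Embedding.coeFn_mk, hf.extend_apply]
          rw [← map_sum, h0, map_zero])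
        (by
          rw [Finset.sum_map]
          simp only [Function.Embedding.coeFn_mk, hf.extend_apply, ← Algebra.smul_def]
          exact h1) (f i) (Finset.mem_map_of_mem ⟨f, hf⟩ hi)
      rw [map_zero, ← hmap, hf.extend_apply])
    (by rwa [hF])
  rw [hF, hX] at key
  nlinarith [Nat.mul_le_mul_left (p ^ 6) hn2]

/-- By Bertrand's postulate, lower bounds along `r * p ^ k` for primes `p` extend to all integers. -/
theorem exists_const_mul_rpow_le {r k e M : ℕ} (hr : 1 ≤ r) (hk : 1 ≤ k) {f : ℕ → ℕ}
    (h1 : ∀ N, r ≤ N → 1 ≤ f N)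
    (hf : ∀ p N : ℕ, p.Prime → M < p → r * p ^ k ≤ N → p ^ e ≤ 2 * f N) :
    ∃ c : ℝ, 0 < c ∧ ∀ N : ℕ, r ≤ N → c * (N : ℝ) ^ (e / k : ℝ) ≤ f N := by
  have hk0 : (k : ℝ) ≠ 0 := by positivity
  have hr0 : (0 : ℝ) < r := by exact_mod_cast hr
  have rpow : ∀ x : ℝ, 0 ≤ x → ((r : ℝ) * x ^ k) ^ (e / k : ℝ) = (r : ℝ) ^ (e / k : ℝ) * x ^ e := by
    intro x hx
    rw [Real.mul_rpow hr0.le (by positivity), ← Real.rpow_natCast x k, ← Real.rpow_mul hx,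
      mul_div_cancel₀ _ hk0, Real.rpow_natCast]
  set R : ℝ := (r : ℝ) ^ (e / k : ℝ) with hR
  have hR0 : 0 < R := by positivity
  set A : ℝ := R * 4 ^ e * 2
  set B : ℝ := R * (2 * (M + 2)) ^ e
  have hA : 0 < A := by positivity
  have hB : 0 < B := by positivity
  refine ⟨(A + B)⁻¹, by positivity, fun N hN => ?_⟩
  rw [inv_mul_le_iff₀ (by positivity), add_mul]
  have hf1 : (1 : ℝ) ≤ f N := by exact_mod_cast h1 N hN
  have hex : ∃ y : ℕ, N < r * (2 * (y + 1)) ^ k := ⟨N, by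
    calc N < 2 * (N + 1) := by omega
      _ ≤ (2 * (N + 1)) ^ k := Nat.le_self_pow (by omega) _
      _ ≤ r * (2 * (N + 1)) ^ k := Nat.le_mul_of_pos_left _ hr⟩
  -- By minimality a prime in `(y, 2 * y]` is admissible for `N`, while `N` is still `O(y ^ k)`.
  -- Bounded `y` is absorbed by `B`.
  obtain ⟨y, hy, hmin⟩ : ∃ y : ℕ, N < r * (2 * (y + 1)) ^ k ∧ (y ≠ 0 → r * (2 * y) ^ k ≤ N) := by
    classical
    refine ⟨Nat.find hex, Nat.find_spec hex, fun h0 => ?_⟩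
    have := Nat.find_min hex (Nat.pred_lt h0)
    rwa [not_lt, ← Nat.succ_eq_add_one, Nat.succ_pred h0] at this
  have hNy : (N : ℝ) ^ (e / k : ℝ) ≤ R * (2 * (y + 1)) ^ e := by
    rw [hR, ← rpow _ (by positivity)]
    refine Real.rpow_le_rpow (by positivity) ?_ (by positivity)
    exact_mod_cast hy.le
  rcases le_or_gt (M + 1) y with hM | hM
  · obtain ⟨p, hp, hyp, hpy⟩ := Nat.exists_prime_lt_and_le_two_mul y (by omega)
    have h3 := hf p N hp (by omega)
      ((Nat.mul_le_mul_left r (Nat.pow_le_pow_left hpy k)).trans (hmin (by omega)))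
    have h4 : (y : ℝ) ^ e ≤ 2 * f N := by
      exact_mod_cast (Nat.pow_le_pow_left hyp.le e).trans h3
    have hy1 : (1 : ℝ) ≤ y := by exact_mod_cast (show 1 ≤ y by omega)
    calc (N : ℝ) ^ (e / k : ℝ) ≤ R * (2 * (y + 1)) ^ e := hNy
      _ ≤ R * (4 * y) ^ e :=
        mul_le_mul_of_nonneg_left (pow_le_pow_left₀ (by positivity) (by linarith) e) hR0.le
      _ = R * 4 ^ e * y ^ e := by rw [mul_pow]; ring
      _ ≤ R * 4 ^ e * (2 * f N) := by gcongr
      _ = A * f N := by ring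
      _ ≤ A * f N + B * f N := le_add_of_nonneg_right (by positivity)
  · have hy' : (y : ℝ) ≤ M := by exact_mod_cast (show y ≤ M by omega)
    calc (N : ℝ) ^ (e / k : ℝ) ≤ R * (2 * (y + 1)) ^ e := hNy
      _ ≤ B := by
        simp only [B]
        gcongr
        norm_num
      _ ≤ B * f N := le_mul_of_one_le_right hB.le hf1
      _ ≤ A * f N + B * f N := le_add_of_nonneg_left (by positivity)

end BergeTuran

theorem theorem2 (r : ℕ) (hr : 2 ≤ r) :
    (∃ c : ℝ, 0 < c ∧ ∀ N : ℕ, r ≤ N →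
      c * (N : ℝ) ^ (10 / 7 : ℝ) ≤ (BergeTuran.exBerge r N 5 : ℝ)) ∧
    (∃ c' : ℝ, 0 < c' ∧ ∀ N : ℕ, r ≤ N →
      c' * (N : ℝ) ^ (4 / 3 : ℝ) ≤ (BergeTuran.exBerge r N 6 : ℝ)) := by
  refine ⟨?_, ?_⟩
  · have := BergeTuran.exists_const_mul_rpow_le (r := r) (k := 7) (e := 10) (by omega)
      (by norm_num) (f := fun N => BergeTuran.exBerge r N 5)
      (fun N hN => BergeTuran.one_le_exBerge hN 5) (fun p N hp hM hN =>
        (BergeTuran.pow_ten_le_exBerge hr hp hM hN).trans (by omega))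
    simpa using this
  · have := BergeTuran.exists_const_mul_rpow_le (r := r) (k := 6) (e := 8) (by omega)
      (by norm_num) (f := fun N => BergeTuran.exBerge r N 6)
      (fun N hN => BergeTuran.one_le_exBerge hN 6) (fun p N hp hM hN =>
        BergeTuran.pow_eight_le_two_mul_exBerge hr hp hM hN)
    norm_num at this
    exact this
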